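/- **Theorem 3.2 (General strong law of large numbers for capacities).** Let $(\Omega,\mathcal F)$ be a measurable space and let $\mathcal H$ be a linear space of real-valued $\mathcal F$-measurable functions on $\Omega$ that contains the constants and the indicators $I_A$ of all $A\in\mathcal F$, and such that $X\in\mathcal H$ implies $|X|\in\mathcal H$. Let $\mathbb E:\mathcal H\to\mathbb R$ be a sublinear expectation, i.e. for all $X,Y\in\mathcal H$, $c\in\mathbb R$ and $\lambda\ge 0$: $\mathbb E[X]\ge\mathbb E[Y]$ if $X\ge Y$; $\mathbb E[c]=c$; $\mathbb E[X]-\mathbb E[Y]\le\mathbb E[X-Y]$; and $\mathbb E[\lambda X]=\lambda\mathbb E[X]$. Put $\mathcal E[X]:=-\mathbb E[-X]$ for $X\in\mathcal H$, and $\mathbb V(A):=\mathbb E[I_A]$, $v(A):=\mathcal E[I_A]$ for $A\in\mathcal F$. Assume that $\mathbb V$ is an upper continuous capacity: $\mathbb V$ takes values in $[0,1]$, $\mathbb V(\emptyset)=0$, $\mathbb V(\Omega)=1$, $\mathbb V(A)\le\mathbb V(B)$ if $A\subset B$, and $\mathbb V(A_n)\downarrow\mathbb V(A)$ whenever $A_n\downarrow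 A$, for $A,B,A_n\in\mathcal F$. A random variable $Y\in\mathcal H$ is called independent of $X=(Y_1,\dots,Y_n)\in\mathcal H^n$ if $\mathbb E[\varphi(X,Y)]=\mathbb E[\overline\varphi(X)]$, where $\overline\varphi(x):=\mathbb E[\varphi(x,Y)]$ for $x\in\mathbb R^n$, for each Borel measurable $\varphi:\mathbb R^{n+1}\to\mathbb R$ such that $\varphi(X,Y)\in\mathcal H$, $\varphi(x,Y)\in\mathcal H$ for all $x\in\mathbb R^n$, and $\overline\varphi(X)\in\mathcal H$. Let $X_1,X_2,\dots\in\mathcal H$ with $|X_i|^2\in\mathcal H$ for all $i$, and suppose that (i) $X_{i+1}$ is independent of $(X_1,\dots,X_i)$ for each $i\ge 1$; (ii) $\mathbb E[X_i]=\overline\mu_i$ and $\mathcal E[X_i]=\underline\mu_i$ for each $i\ge 1$ (so $-\infty<\underline\mu_i\le\overline\mu_i<\infty$); (iii) there are real constants $\underline\mu$ and $\overline\mu$ with $$\lim_{n\to\infty}\frac1n\sum_{i=1}^n|\underline\mu_i-\underline\mu|=0,\qquad \lim_{n\to\infty}\frac1n\sum_{i=1}^n|\overline\mu_i-\overline\mu|=0;$$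 (iv) $\sup_{i\ge1}\mathbb E[|X_i|^2]<\infty$. Let $S_n:=\sum_{i=1}^nX_i$. Then all events below belong to $\mathcal F$, and the following hold. (I) $v\left(\underline\mu\le\liminf_{n\to\infty}S_n/n\le\limsup_{n\to\infty}S_n/n\le\overline\mu\right)=1$. (II) For every $b\in[\underline\mu,\overline\mu]$, $\ \mathbb V\left(\liminf_{n\to\infty}|S_n/n-b|=0\right)=1$. (III) $\mathbb V\left(\limsup_{n\to\infty}S_n/n=\overline\mu\right)=1$ and $\mathbb V\left(\liminf_{n\to\infty}S_n/n=\underline\mu\right)=1$. -/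

import Mathlib

open Filter Topology

/-- A sublinear expectation space over a measurable space `(Ω, 𝓕)`: a linear space `H` of real
functions on `Ω` ("random variables") containing the constants and closed under absolute values,
with a sublinear expectation `E : H → ℝ`.

The events `A ∈ 𝓕` are measured by `E[I_A]`, so their indicators lie in `H`; random variables are
`𝓕`-measurable.  Together the two conditions say that `𝓕` is the `σ`-algebra generated by `H`
and that its indicators belong to `H`. -/
structure SublinearExpectationSpace (Ω : Type*) [MeasurableSpace Ω] where
  /-- The space of random variables. -/
  H : Submodule ℝ (Ω → ℝ)
  const_mem : ∀ c : ℝ, (fun _ : Ω => c) ∈ H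
  abs_mem : ∀ {f : Ω → ℝ}, f ∈ H → (fun ω => |f ω|) ∈ H
  measurable_of_mem : ∀ {f : Ω → ℝ}, f ∈ H → Measurable f
  indicator_mem : ∀ {A : Set Ω}, MeasurableSet A → A.indicator (fun _ => (1 : ℝ)) ∈ H
  /-- The sublinear expectation. -/
  E : H → ℝ
  mono : ∀ X Y : H, (∀ ω, (Y : Ω → ℝ) ω ≤ (X : Ω → ℝ) ω) → E Y ≤ E X
  const : ∀ c : ℝ, E ⟨fun _ => c, const_mem c⟩ = c
  subadd : ∀ X Y : H, E X - E Y ≤ E (X - Y)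
  pos_homog : ∀ (c : ℝ) (X : H), 0 ≤ c → E (c • X) = c * E X

/-- The events of `Ω`, that is, the members of its `σ`-algebra. -/
abbrev Event (Ω : Type*) [MeasurableSpace Ω] := {A : Set Ω // MeasurableSet A}

/-- An upper continuous capacity: a normalized monotone set function on the `σ`-algebra, with
values in `[0, 1]`, that is continuous along decreasing sequences of events. -/
structure IsUpperContinuousCapacity {Ω : Type*} [MeasurableSpace Ω] (V : Event Ω → ℝ) :
    Prop where
  mem_Icc : ∀ A, V A ∈ Set.Icc (0 : ℝ) 1
  empty : V ⟨∅, MeasurableSet.empty⟩ = 0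
  univ : V ⟨Set.univ, MeasurableSet.univ⟩ = 1
  mono : ∀ A B : Event Ω, (A : Set Ω) ⊆ (B : Set Ω) → V A ≤ V B
  continuous_of_antitone : ∀ (A : ℕ → Event Ω) (B : Event Ω),
    Antitone (fun n => (A n : Set Ω)) → (⋂ n, (A n : Set Ω)) = (B : Set Ω) →
      Tendsto (fun n => V (A n)) atTop (𝓝 (V B))

namespace SublinearExpectationSpace

variable {Ω : Type*} [MeasurableSpace Ω] (S : SublinearExpectationSpace Ω)

/-- The conjugate expectation `𝓔[X] = -E[-X]`. -/
def conj (X : S.H) : ℝ := -S.E (-X)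

/-- The indicator of an event as a random variable. -/
noncomputable def ind (A : Event Ω) : S.H :=
  ⟨(A : Set Ω).indicator (fun _ => (1 : ℝ)), S.indicator_mem A.2⟩

/-- The upper capacity `𝕍(A) = E[I_A]`. -/
noncomputable def upperCapacity (A : Event Ω) : ℝ := S.E (S.ind A)

/-- The lower capacity `v(A) = 𝓔[I_A]`. -/
noncomputable def lowerCapacity (A : Event Ω) : ℝ := S.conj (S.ind A)

/-- `Y` is independent of the random vector `X = (X₁, …, Xₙ)` under `E`: one has
`E[φ(X, Y)] = E[φ̄(X)]`, where `φ̄(x) = E[φ(x, Y)]`, for each Borel function `φ` on `ℝⁿ × ℝ` for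
which the random variables `φ(X, Y)`, `φ(x, Y)` (for all `x ∈ ℝⁿ`) and `φ̄(X)` belong to `H`. -/
def IsIndependentOf {n : ℕ} (Y : S.H) (X : Fin n → S.H) : Prop :=
  ∀ φ : (Fin n → ℝ) × ℝ → ℝ, Measurable φ →
    ∀ (hXY : (fun ω => φ (fun j => (X j : Ω → ℝ) ω, (Y : Ω → ℝ) ω)) ∈ S.H)
      (hxY : ∀ x : Fin n → ℝ, (fun ω => φ (x, (Y : Ω → ℝ) ω)) ∈ S.H)
      (hX : (fun ω => S.E ⟨_, hxY (fun j => (X j : Ω → ℝ) ω)⟩) ∈ S.H),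
      S.E ⟨_, hXY⟩ = S.E ⟨_, hX⟩

end SublinearExpectationSpace

/-- The sample mean of the first `n` terms of a sequence of functions indexed from `0`. -/
noncomputable def sampleMean {Ω : Type*} (X : ℕ → Ω → ℝ) (n : ℕ) (ω : Ω) : ℝ :=
  (∑ i ∈ Finset.range n, X i ω) / (n : ℝ)

/-! The proof combines a weak law with an explicit rate, Borel–Cantelli along the squares, and upper
continuity of the capacity.

Independence may be used only for test functions whose compositions lie in `H`, and `H` need not be
closed under products or truncation. It does contain all simple functions, and a test function of
simple functions is always admissible (`IsIndependentOf.expect_simpleFunc`). Bounded second moments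
give simple functions `g i` with `g i (X i)` arbitrarily close to `X i` in mean
(`exists_simpleFunc_expect_abs_sub_le`). For a fixed number `N` of summands the total error is at
most `N * δ`, and `δ` is free, so estimates proved for simple functions pass to the `X i`.

Two second-moment inductions then give capacity estimates with error `O(1/N)`. If the centred terms
have upper mean at most zero, the squared positive part of their sum has upper expectation at most
`N * D`; Markov's inequality bounds upward deviations. If zero lies between the lower and upper
means, the upper expectation of minus the squared sum is at least `-(N * D)`; hence the upper
capacity of a sample mean near any admissible average is close to one.

Upper continuity makes the capacity countably subadditive, so Borel–Cantelli applies. The first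
estimate along squares, with a crude bound on the gaps, gives the upper half of (I); the lower half
is the same for `-X`. For (II), the second estimate gives full capacity to each decreasing set "the
mean comes near `b` after time `m`", and upper continuity passes this to the intersection, with no
second Borel–Cantelli lemma. (III) is (II) at an endpoint, outside a null set from (I). -/

namespace SublinearExpectationSpace

open MeasureTheory

variable {Ω : Type*} [MeasurableSpace Ω] (S : SublinearExpectationSpace Ω)

/-! ### Calculus of the sublinear expectation -/

open Classical in
/-- The sublinear expectation as a function of arbitrary real functions, with value `0` outside
the space of random variables. -/
noncomputable def expect (f : Ω → ℝ) : ℝ := if h : f ∈ S.H then S.E ⟨f, h⟩ else 0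

/-- The upper capacity as a function of arbitrary sets. -/
noncomputable def capacity (A : Set Ω) : ℝ := S.expect (A.indicator fun _ => (1 : ℝ))

variable {S}

theorem expect_eq {f : Ω → ℝ} (h : f ∈ S.H) : S.expect f = S.E ⟨f, h⟩ := dif_pos h

theorem expect_coe (X : S.H) : S.expect (fun ω => (X : Ω → ℝ) ω) = S.E X := dif_pos X.2

theorem capacity_eq {A : Set Ω} (hA : MeasurableSet A) :
    S.capacity A = S.upperCapacity ⟨A, hA⟩ := dif_pos (S.indicator_mem hA)

theorem add_mem {f g : Ω → ℝ} (hf : f ∈ S.H) (hg : g ∈ S.H) : (fun ω => f ω + g ω) ∈ S.H :=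
  S.H.add_mem hf hg

theorem sub_mem {f g : Ω → ℝ} (hf : f ∈ S.H) (hg : g ∈ S.H) : (fun ω => f ω - g ω) ∈ S.H :=
  S.H.sub_mem hf hg

theorem neg_mem {f : Ω → ℝ} (hf : f ∈ S.H) : (fun ω => -f ω) ∈ S.H :=
  S.H.neg_mem hf

theorem mul_mem {f : Ω → ℝ} (c : ℝ) (hf : f ∈ S.H) : (fun ω => c * f ω) ∈ S.H :=
  S.H.smul_mem c hf

theorem sum_mem {ι : Type*} {s : Finset ι} {f : ι → Ω → ℝ} (hf : ∀ i ∈ s, f i ∈ S.H) :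
    (fun ω => ∑ i ∈ s, f i ω) ∈ S.H := by
  have h := S.H.sum_mem hf
  rwa [Finset.sum_fn] at h

theorem expect_mono {f g : Ω → ℝ} (hf : f ∈ S.H) (hg : g ∈ S.H) (h : ∀ ω, f ω ≤ g ω) :
    S.expect f ≤ S.expect g := by
  rw [expect_eq hf, expect_eq hg]
  exact S.mono ⟨g, hg⟩ ⟨f, hf⟩ h

theorem expect_const (c : ℝ) : S.expect (fun _ => c) = c := by
  rw [expect_eq (S.const_mem c)]
  exact S.const c

theorem expect_add_le {f g : Ω → ℝ} (hf : f ∈ S.H) (hg : g ∈ S.H) :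
    S.expect (fun ω => f ω + g ω) ≤ S.expect f + S.expect g := by
  rw [expect_eq hf, expect_eq hg, expect_eq (add_mem hf hg)]
  have h := S.subadd ⟨_, add_mem hf hg⟩ ⟨g, hg⟩
  have e : (⟨_, add_mem hf hg⟩ - ⟨g, hg⟩ : S.H) = ⟨f, hf⟩ := by
    apply Subtype.ext
    funext ω
    simp
  rw [e] at h
  linarith

theorem expect_mul {f : Ω → ℝ} (hf : f ∈ S.H) {c : ℝ} (hc : 0 ≤ c) :
    S.expect (fun ω => c * f ω) = c * S.expect f := by
  rw [expect_eq hf, expect_eq (mul_mem c hf)]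
  exact S.pos_homog c ⟨f, hf⟩ hc

theorem expect_sum_le {ι : Type*} (s : Finset ι) {f : ι → Ω → ℝ} (hf : ∀ i, f i ∈ S.H) :
    S.expect (fun ω => ∑ i ∈ s, f i ω) ≤ ∑ i ∈ s, S.expect (f i) := by
  classical
  induction s using Finset.induction_on with
  | empty => simp [expect_const]
  | insert a s ha ih =>
    simp only [Finset.sum_insert ha]
    have := expect_add_le (hf a) (sum_mem (s := s) fun i _ => hf i)
    linarith

theorem expect_add_const {f : Ω → ℝ} (hf : f ∈ S.H) (c : ℝ) :
    S.expect (fun ω => f ω + c) = S.expect f + c := by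
  apply le_antisymm
  · simpa [expect_const] using expect_add_le hf (S.const_mem c)
  · have := expect_add_le (add_mem hf (S.const_mem c)) (S.const_mem (-c))
    simp only [add_neg_cancel_right, expect_const] at this
    linarith

theorem neg_expect_neg_le {f : Ω → ℝ} (hf : f ∈ S.H) :
    -S.expect (fun ω => -f ω) ≤ S.expect f := by
  have := expect_add_le hf (neg_mem hf)
  simp only [add_neg_cancel, expect_const] at this
  linarith

theorem expect_le_add_abs_sub {f g : Ω → ℝ} (hf : f ∈ S.H) (hg : g ∈ S.H) :
    S.expect f ≤ S.expect g + S.expect (fun ω => |f ω - g ω|) := by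
  have hd := S.abs_mem (sub_mem hf hg)
  refine (expect_mono hf (add_mem hg hd) fun ω => ?_).trans (expect_add_le hg hd)
  linarith [le_abs_self (f ω - g ω)]

/-! ### Simple functions and independence -/

theorem simpleFunc_mem (s : SimpleFunc Ω ℝ) : (s : Ω → ℝ) ∈ S.H := by
  induction s using SimpleFunc.induction with
  | @const c A hA =>
    have h := mul_mem c (S.indicator_mem hA)
    convert h using 1
    funext ω
    by_cases hω : ω ∈ A <;> simp [hω]
  | add _ hf hg => exact S.H.add_mem hf hg

theorem simpleFunc_comp_mem {α : Type*} [MeasurableSpace α] (s : SimpleFunc α ℝ) {X : Ω → α}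
    (hX : Measurable X) : (fun ω => s (X ω)) ∈ S.H :=
  simpleFunc_mem (s.comp X hX)

theorem measurable_coe (X : S.H) : Measurable (X : Ω → ℝ) := S.measurable_of_mem X.2

/-- Independence applied to functions of simple functions, for which it needs no integrability
assumptions. -/
theorem IsIndependentOf.expect_simpleFunc {n : ℕ} {Y : S.H} {X : Fin n → S.H}
    (h : S.IsIndependentOf Y X) (t : SimpleFunc (Fin n → ℝ) ℝ) (g : SimpleFunc ℝ ℝ)
    (F : ℝ → ℝ → ℝ) :
    S.expect (fun ω => F (t fun j => (X j : Ω → ℝ) ω) (g ((Y : Ω → ℝ) ω))) =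
      S.expect fun ω => S.expect fun ω' =>
        F (t fun j => (X j : Ω → ℝ) ω) (g ((Y : Ω → ℝ) ω')) := by
  have mX : Measurable fun ω => fun j => (X j : Ω → ℝ) ω :=
    measurable_pi_lambda _ fun j => measurable_coe _
  have mY := measurable_coe Y
  let φ : SimpleFunc ((Fin n → ℝ) × ℝ) ℝ :=
    ((t.comp Prod.fst measurable_fst).pair (g.comp Prod.snd measurable_snd)).map fun p => F p.1 p.2
  have h1 := simpleFunc_comp_mem (S := S) φ (mX.prodMk mY)
  have h2 : ∀ x, (fun ω => φ (x, (Y : Ω → ℝ) ω)) ∈ S.H := fun x =>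
    simpleFunc_comp_mem (S := S) φ (measurable_const.prodMk mY)
  -- The inner expectation depends on the vector only through the value of `t`, so it is again a
  -- simple function of it.
  have h3 : (fun ω => S.E ⟨_, h2 (fun j => (X j : Ω → ℝ) ω)⟩) ∈ S.H := by
    have := simpleFunc_comp_mem (S := S)
      (t.map fun a => S.expect fun ω' => F a (g ((Y : Ω → ℝ) ω'))) mX
    convert this using 2 with ω
    exact (expect_eq (h2 _)).symm
  have key := h φ φ.measurable h1 h2 h3
  rw [← expect_eq h1, ← expect_eq h3] at key
  refine key.trans ?_
  congr 1
  funext ω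
  exact (expect_eq (h2 _)).symm

/-- The partial sum is a simple function of the past vector, so the last summand can be integrated
first with the sum frozen. This is the induction step of both second-moment bounds. For `n = 0` the
sum is empty and no independence is needed. -/
theorem expect_indep_sum {X : ℕ → S.H}
    (hindep : ∀ n : ℕ, S.IsIndependentOf (X (n + 1)) (fun j : Fin (n + 1) => X j))
    (g : ℕ → SimpleFunc ℝ ℝ) (F : ℝ → ℝ → ℝ) (n : ℕ) :
    S.expect (fun ω => F (∑ i ∈ Finset.range n, g i ((X i : Ω → ℝ) ω)) (g n ((X n : Ω → ℝ) ω))) =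
      S.expect fun ω => S.expect fun ω' =>
        F (∑ i ∈ Finset.range n, g i ((X i : Ω → ℝ) ω)) (g n ((X n : Ω → ℝ) ω')) := by
  cases n with
  | zero => simp [expect_const]
  | succ n =>
    let t : SimpleFunc (Fin (n + 1) → ℝ) ℝ :=
      ∑ j : Fin (n + 1), (g j).comp (fun x => x j) (measurable_pi_apply j)
    have ht : ∀ x, t x = ∑ j : Fin (n + 1), g j (x j) := by
      intro x
      simp only [t]
      induction (Finset.univ : Finset (Fin (n + 1))) using Finset.induction_on with
      | empty => simp
      | insert a s ha ih => simp [Finset.sum_insert ha, ih]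
    have := (hindep n).expect_simpleFunc t (g (n + 1)) F
    simp only [ht] at this
    simp only [← Fin.sum_univ_eq_sum_range (fun i => g i ((X i : Ω → ℝ) _))]
    exact this

theorem sum_simpleFunc_comp_mem (X : ℕ → S.H) (g : ℕ → SimpleFunc ℝ ℝ) (F : ℝ → ℝ) (n : ℕ) :
    (fun ω => F (∑ i ∈ Finset.range n, g i ((X i : Ω → ℝ) ω))) ∈ S.H := by
  let t : SimpleFunc Ω ℝ := ∑ i ∈ Finset.range n, (g i).comp _ (measurable_coe (X i))
  have ht : ∀ ω, t ω = ∑ i ∈ Finset.range n, g i ((X i : Ω → ℝ) ω) := by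
    intro ω
    simp only [t]
    induction (Finset.range n) using Finset.induction_on with
    | empty => simp
    | insert a s ha ih => simp [Finset.sum_insert ha, ih]
  have := simpleFunc_mem (S := S) (t.map F)
  convert this using 2 with ω
  simp [ht]

/-! ### Second-moment bounds for sums of simple functions -/

/-- Pointwise `((a + y)⁺)² ≤ (a⁺)² + 2 a⁺ y + y²`. The coefficient of `y` is nonnegative, so a bound
on the upper mean alone disposes of the cross term; the full square would give a coefficient of
either sign. -/
theorem expect_sq_posPart_sum_le {X : ℕ → S.H}
    (hindep : ∀ n : ℕ, S.IsIndependentOf (X (n + 1)) (fun j : Fin (n + 1) => X j))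
    (g : ℕ → SimpleFunc ℝ ℝ) {D : ℝ}
    (hmean : ∀ i, S.expect (fun ω => g i ((X i : Ω → ℝ) ω)) ≤ 0)
    (hvar : ∀ i, S.expect (fun ω => g i ((X i : Ω → ℝ) ω) ^ 2) ≤ D) (n : ℕ) :
    S.expect (fun ω => max (∑ i ∈ Finset.range n, g i ((X i : Ω → ℝ) ω)) 0 ^ 2) ≤ n * D := by
  induction n with
  | zero => simp [expect_const]
  | succ n ih =>
    simp only [Finset.sum_range_succ]
    have key := expect_indep_sum hindep g (fun a b => max (a + b) 0 ^ 2) n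
    rw [key]
    have hg : ∀ F : ℝ → ℝ, (fun ω => F (g n ((X n : Ω → ℝ) ω))) ∈ S.H := fun F =>
      simpleFunc_comp_mem ((g n).map F) (measurable_coe _)
    have inner : ∀ a : ℝ, S.expect (fun ω => max (a + g n ((X n : Ω → ℝ) ω)) 0 ^ 2) ≤
        max a 0 ^ 2 + D := by
      intro a
      have h1 : S.expect (fun ω => max (a + g n ((X n : Ω → ℝ) ω)) 0 ^ 2) ≤
          S.expect (fun ω => (2 * max a 0 * g n ((X n : Ω → ℝ) ω) +
            g n ((X n : Ω → ℝ) ω) ^ 2) + max a 0 ^ 2) := by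
        refine expect_mono (hg fun y => max (a + y) 0 ^ 2)
          (hg fun y => (2 * max a 0 * y + y ^ 2) + max a 0 ^ 2) fun ω => ?_
        set y := g n ((X n : Ω → ℝ) ω)
        have : |max (a + y) 0| ≤ |max a 0 + y| := by
          rw [abs_of_nonneg (le_max_right _ _)]
          refine max_le ?_ (abs_nonneg _)
          exact le_trans (by linarith [le_max_left a 0]) (le_abs_self _)
        have := sq_le_sq.mpr this
        linarith
      rw [expect_add_const (hg fun y => 2 * max a 0 * y + y ^ 2)] at h1
      have h2 := expect_add_le (hg fun y => 2 * max a 0 * y) (hg fun y => y ^ 2)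
      rw [expect_mul (hg fun y => y) (by positivity)] at h2
      have h3 := mul_nonpos_of_nonneg_of_nonpos
        (show 0 ≤ 2 * max a 0 by positivity) (hmean n)
      linarith [hvar n]
    have h1 := expect_mono (sum_simpleFunc_comp_mem X g
        (fun a => S.expect (fun ω => max (a + g n ((X n : Ω → ℝ) ω)) 0 ^ 2)) n)
      (sum_simpleFunc_comp_mem X g (fun a => max a 0 ^ 2 + D) n) fun ω => inner _
    rw [expect_add_const (sum_simpleFunc_comp_mem X g (fun a => max a 0 ^ 2) n)] at h1
    push_cast
    linarith

/-- Here the cross term `-2 a y` has a coefficient of unknown sign, but only a lower bound for its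
upper expectation is required. The two mean conditions say that zero lies between the lower and
upper means, which makes that expectation nonnegative for every `a`. -/
theorem le_expect_neg_sq_sum {X : ℕ → S.H}
    (hindep : ∀ n : ℕ, S.IsIndependentOf (X (n + 1)) (fun j : Fin (n + 1) => X j))
    (g : ℕ → SimpleFunc ℝ ℝ) {D : ℝ}
    (hmean : ∀ i, 0 ≤ S.expect (fun ω => g i ((X i : Ω → ℝ) ω)))
    (hmean' : ∀ i, 0 ≤ S.expect (fun ω => -g i ((X i : Ω → ℝ) ω)))
    (hvar : ∀ i, S.expect (fun ω => g i ((X i : Ω → ℝ) ω) ^ 2) ≤ D) (n : ℕ) :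
    -(n * D) ≤ S.expect (fun ω => -(∑ i ∈ Finset.range n, g i ((X i : Ω → ℝ) ω)) ^ 2) := by
  induction n with
  | zero => simp [expect_const]
  | succ n ih =>
    simp only [Finset.sum_range_succ]
    have key := expect_indep_sum hindep g (fun a b => -(a + b) ^ 2) n
    rw [key]
    have hg : ∀ F : ℝ → ℝ, (fun ω => F (g n ((X n : Ω → ℝ) ω))) ∈ S.H := fun F =>
      simpleFunc_comp_mem ((g n).map F) (measurable_coe _)
    have hlin : ∀ c : ℝ, 0 ≤ S.expect (fun ω => c * g n ((X n : Ω → ℝ) ω)) := by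
      intro c
      rcases le_total 0 c with hc | hc
      · rw [expect_mul (hg fun y => y) hc]
        exact mul_nonneg hc (hmean n)
      · have := expect_mul (S := S) (hg fun y => -y) (neg_nonneg.mpr hc)
        simp only [neg_mul_neg] at this
        rw [this]
        exact mul_nonneg (by linarith) (hmean' n)
    have inner : ∀ a : ℝ, -a ^ 2 + -D ≤ S.expect (fun ω => -(a + g n ((X n : Ω → ℝ) ω)) ^ 2) := by
      intro a
      have h1 := expect_add_le (hg fun y => -(a + y) ^ 2) (hg fun y => y ^ 2)
      have h2 : S.expect (fun ω => (-2 * a) * g n ((X n : Ω → ℝ) ω) + -a ^ 2) ≤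
          S.expect (fun ω => -(a + g n ((X n : Ω → ℝ) ω)) ^ 2 + g n ((X n : Ω → ℝ) ω) ^ 2) := by
        refine expect_mono (hg fun y => (-2 * a) * y + -a ^ 2)
          (hg fun y => -(a + y) ^ 2 + y ^ 2) fun ω => ?_
        apply le_of_eq
        ring
      rw [expect_add_const (hg fun y => (-2 * a) * y)] at h2
      linarith [hvar n, hlin (-2 * a)]
    have h1 := expect_mono (sum_simpleFunc_comp_mem X g (fun a => -a ^ 2 + -D) n)
      (sum_simpleFunc_comp_mem X g
        (fun a => S.expect (fun ω => -(a + g n ((X n : Ω → ℝ) ω)) ^ 2)) n) fun ω => inner _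
    rw [expect_add_const (sum_simpleFunc_comp_mem X g (fun a => -a ^ 2) n)] at h1
    push_cast
    linarith

/-- A random variable with finite second moment is approximated in mean by simple functions of
itself. -/
theorem exists_simpleFunc_expect_abs_sub_le {C δ : ℝ} (hC : 0 < C) (hδ : 0 < δ) {X : S.H}
    (hsq : (fun ω => (X : Ω → ℝ) ω ^ 2) ∈ S.H)
    (hle : S.expect (fun ω => (X : Ω → ℝ) ω ^ 2) ≤ C) :
    ∃ g : SimpleFunc ℝ ℝ, (∀ y, |g y| ≤ |y| + 1) ∧
      S.expect (fun ω => |(X : Ω → ℝ) ω - g ((X : Ω → ℝ) ω)|) ≤ δ := by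
  obtain ⟨η, hη, hη1, hηδ⟩ : ∃ η : ℝ, 0 < η ∧ η ≤ 1 ∧ η ≤ δ / 2 :=
    ⟨min 1 (δ / 2), by positivity, min_le_left _ _, min_le_right _ _⟩
  -- Truncate at level `c` and round down to multiples of `η`. Beyond `c` one has `|y| ≤ y² / c`, so
  -- the tail costs at most `C / c = δ / 2` and the rounding at most `η ≤ δ / 2`; `η ≤ 1` gives the
  -- growth bound.
  set c : ℝ := 2 * C / δ with hc
  have hc0 : 0 < c := by positivity
  let f : ℝ → ℝ := fun y => if |y| ≤ c then η * (⌊y / η⌋ : ℝ) else 0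
  have hfm : Measurable f := by
    refine Measurable.ite (measurableSet_le (by fun_prop) measurable_const) ?_ measurable_const
    have : Measurable fun y : ℝ => ⌊y / η⌋ := Int.measurable_floor.comp (by fun_prop)
    exact ((measurable_from_top (f := fun z : ℤ => (z : ℝ))).comp this).const_mul η
  have hfr : (Set.range f).Finite := by
    have : Set.range f ⊆ insert 0 ((fun z : ℤ => η * (z : ℝ)) '' Set.Icc ⌊-c / η⌋ ⌊c / η⌋) := by
      rintro _ ⟨y, rfl⟩
      by_cases hy : |y| ≤ c
      · right
        refine ⟨⌊y / η⌋, ⟨Int.floor_le_floor ?_, Int.floor_le_floor ?_⟩, by simp [f, hy]⟩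
        · exact div_le_div_of_nonneg_right (abs_le.mp hy).1 hη.le
        · exact div_le_div_of_nonneg_right (abs_le.mp hy).2 hη.le
      · left
        simp [f, hy]
    exact (((Set.finite_Icc _ _).image _).insert 0).subset this
  let g : SimpleFunc ℝ ℝ := ⟨f, fun x => hfm (measurableSet_singleton x), hfr⟩
  have hgf : ∀ y, g y = f y := fun y => rfl
  have hclose : ∀ y, |y| ≤ c → |y - g y| ≤ η := by
    intro y hy
    simp only [hgf, f, hy, if_true]
    have h1 : η * (⌊y / η⌋ : ℝ) ≤ η * (y / η) :=
      mul_le_mul_of_nonneg_left (Int.floor_le _) hη.le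
    have h2 : η * (y / η) ≤ η * ((⌊y / η⌋ : ℝ) + 1) :=
      mul_le_mul_of_nonneg_left (Int.lt_floor_add_one _).le hη.le
    rw [mul_div_cancel₀ _ hη.ne'] at h1 h2
    rw [abs_le]
    constructor <;> linarith
  have hfar : ∀ y, ¬|y| ≤ c → g y = 0 := fun y hy => by simp [hgf, f, hy]
  refine ⟨g, fun y => ?_, ?_⟩
  · by_cases hy : |y| ≤ c
    · have := abs_sub_abs_le_abs_sub (g y) y
      rw [abs_sub_comm] at this
      linarith [hclose y hy]
    · rw [hfar y hy, abs_zero]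
      positivity
  · have hg := simpleFunc_comp_mem (S := S) g (measurable_coe X)
    refine (expect_mono (S.abs_mem (sub_mem X.2 hg))
      (add_mem (mul_mem c⁻¹ hsq) (S.const_mem η)) fun ω => ?_).trans ?_
    · set y := (X : Ω → ℝ) ω
      by_cases hy : |y| ≤ c
      · have := hclose y hy
        have : 0 ≤ c⁻¹ * y ^ 2 := by positivity
        linarith
      · rw [hfar y hy, sub_zero]
        have : |y| ≤ c⁻¹ * y ^ 2 := by
          rw [← sq_abs, inv_mul_eq_div, le_div_iff₀ hc0]
          nlinarith [abs_nonneg y]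
        linarith
    · rw [expect_add_const (mul_mem c⁻¹ hsq), expect_mul hsq (by positivity)]
      have : c⁻¹ * S.expect (fun ω => (X : Ω → ℝ) ω ^ 2) ≤ c⁻¹ * C :=
        mul_le_mul_of_nonneg_left hle (by positivity)
      have h2 : c⁻¹ * C = δ / 2 := by
        rw [hc]
        field_simp
      linarith

/-! ### Capacity: countable subadditivity and Borel–Cantelli -/

theorem capacity_mono {A B : Set Ω} (hA : MeasurableSet A) (hB : MeasurableSet B) (h : A ⊆ B) :
    S.capacity A ≤ S.capacity B :=
  expect_mono (S.indicator_mem hA) (S.indicator_mem hB) fun ω =>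
    Set.indicator_le_indicator_of_subset h (fun _ => zero_le_one) ω

theorem capacity_nonneg {A : Set Ω} (hA : MeasurableSet A) : 0 ≤ S.capacity A := by
  have := expect_mono (S.const_mem 0) (S.indicator_mem hA) fun ω =>
    Set.indicator_nonneg (fun _ _ => zero_le_one) ω
  rwa [expect_const] at this

theorem capacity_empty : S.capacity ∅ = 0 := by
  simp [capacity, expect_const]

theorem capacity_le_expect {A : Set Ω} (hA : MeasurableSet A) {f : Ω → ℝ} (hf : f ∈ S.H)
    (h0 : ∀ ω, 0 ≤ f ω) (h1 : ∀ ω ∈ A, 1 ≤ f ω) : S.capacity A ≤ S.expect f :=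
  expect_mono (S.indicator_mem hA) hf fun ω => by
    by_cases hω : ω ∈ A
    · simpa [hω] using h1 ω hω
    · simpa [hω] using h0 ω

theorem capacity_union_le {A B : Set Ω} (hA : MeasurableSet A) (hB : MeasurableSet B) :
    S.capacity (A ∪ B) ≤ S.capacity A + S.capacity B := by
  refine (expect_mono (S.indicator_mem (hA.union hB))
    (add_mem (S.indicator_mem hA) (S.indicator_mem hB)) fun ω => ?_).trans
    (expect_add_le (S.indicator_mem hA) (S.indicator_mem hB))
  by_cases h1 : ω ∈ A <;> by_cases h2 : ω ∈ B <;> simp [h1, h2]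

theorem tendsto_capacity_of_antitone (hV : IsUpperContinuousCapacity S.upperCapacity)
    {A : ℕ → Set Ω} (hA : ∀ n, MeasurableSet (A n)) (hmono : Antitone A) :
    Tendsto (fun n => S.capacity (A n)) atTop (𝓝 (S.capacity (⋂ n, A n))) := by
  have := hV.continuous_of_antitone (fun n => ⟨A n, hA n⟩) ⟨⋂ n, A n, .iInter hA⟩ hmono rfl
  simpa only [← capacity_eq] using this

theorem capacity_partialUnion_le {A : ℕ → Set Ω} (hA : ∀ n, MeasurableSet (A n)) (n : ℕ) :
    S.capacity (⋃ i ∈ Finset.range n, A i) ≤ ∑ i ∈ Finset.range n, S.capacity (A i) := by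
  induction n with
  | zero => simp [capacity_empty]
  | succ n ih =>
    rw [Finset.sum_range_succ, Finset.range_add_one, Finset.set_biUnion_insert, Set.union_comm]
    have := capacity_union_le (S := S) (Finset.measurableSet_biUnion (Finset.range n)
      fun i _ => hA i) (hA n)
    linarith

/-- An upper continuous capacity coming from a sublinear expectation is countably subadditive. -/
theorem capacity_iUnion_le (hV : IsUpperContinuousCapacity S.upperCapacity)
    {A : ℕ → Set Ω} (hA : ∀ n, MeasurableSet (A n)) {a : ℕ → ℝ} (ha : Summable a)
    (hle : ∀ n, S.capacity (A n) ≤ a n) : S.capacity (⋃ n, A n) ≤ ∑' n, a n := by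
  -- The remainders decrease to the empty set, so upper continuity sends their capacities to zero;
  -- finite subadditivity handles the rest.
  let R : ℕ → Set Ω := fun n => (⋃ i, A i) \ ⋃ i ∈ Finset.range n, A i
  have hm : ∀ n, MeasurableSet (⋃ i ∈ Finset.range n, A i) := fun n =>
    Finset.measurableSet_biUnion _ fun i _ => hA i
  have hR : ∀ n, MeasurableSet (R n) := fun n => (MeasurableSet.iUnion hA).diff (hm n)
  have hanti : Antitone R := fun m n hmn =>
    Set.sdiff_subset_sdiff_right (Set.biUnion_subset_biUnion_left
      (Finset.coe_subset.mpr (Finset.range_mono hmn)))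
  have hempty : ⋂ n, R n = ∅ := by
    rw [Set.eq_empty_iff_forall_notMem]
    intro ω hω
    rw [Set.mem_iInter] at hω
    obtain ⟨i, hi⟩ := Set.mem_iUnion.mp (hω 0).1
    exact (hω (i + 1)).2 (Set.mem_biUnion (Finset.mem_coe.mpr (Finset.self_mem_range_succ i)) hi)
  have hlim := tendsto_capacity_of_antitone hV hR hanti
  rw [hempty, capacity_empty] at hlim
  have ha0 : ∀ n, 0 ≤ a n := fun n => (capacity_nonneg (hA n)).trans (hle n)
  refine ge_of_tendsto' (b := S.capacity (⋃ n, A n)) (hlim.const_add (∑' n, a n)) (fun n => ?_)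
    |>.trans_eq (add_zero _)
  have hsub : ⋃ i, A i ⊆ (⋃ i ∈ Finset.range n, A i) ∪ R n := fun ω hω => by
    by_cases h : ω ∈ ⋃ i ∈ Finset.range n, A i
    · exact Or.inl h
    · exact Or.inr ⟨hω, h⟩
  have h1 := capacity_mono (S := S) (.iUnion hA) ((hm n).union (hR n)) hsub
  have h2 := capacity_union_le (S := S) (hm n) (hR n)
  have h3 := capacity_partialUnion_le (S := S) hA n
  have h4 := Finset.sum_le_sum fun i (_ : i ∈ Finset.range n) => hle i
  have h5 := ha.sum_le_tsum (Finset.range n) fun i _ => ha0 i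
  linarith

theorem capacity_iUnion_eq_zero (hV : IsUpperContinuousCapacity S.upperCapacity)
    {A : ℕ → Set Ω} (hA : ∀ n, MeasurableSet (A n)) (h0 : ∀ n, S.capacity (A n) = 0) :
    S.capacity (⋃ n, A n) = 0 := by
  have := capacity_iUnion_le hV hA (a := fun _ => 0) summable_zero fun n => (h0 n).le
  rw [tsum_zero] at this
  exact le_antisymm this (capacity_nonneg (.iUnion hA))

/-- The first Borel–Cantelli lemma for upper continuous capacities. -/
theorem capacity_frequently_eq_zero (hV : IsUpperContinuousCapacity S.upperCapacity)
    {A : ℕ → Set Ω} (hA : ∀ n, MeasurableSet (A n)) {a : ℕ → ℝ} (ha : Summable a)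
    (hle : ∀ n, S.capacity (A n) ≤ a n) : S.capacity (⋂ m, ⋃ n, A (n + m)) = 0 := by
  have hU : ∀ m, MeasurableSet (⋃ n, A (n + m)) := fun m => .iUnion fun n => hA _
  refine le_antisymm ?_ (capacity_nonneg (.iInter hU))
  refine ge_of_tendsto' (tendsto_sum_nat_add a) fun m => ?_
  refine (capacity_mono (.iInter hU) (hU m) (Set.iInter_subset _ m)).trans ?_
  exact capacity_iUnion_le hV (fun n => hA _) ((summable_nat_add_iff m).mpr ha) fun n => hle _

/-- From `-I_A = I_{Aᶜ} - 1` and translation by constants, `v(A) = 1 - 𝕍(Aᶜ)`. -/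
theorem lowerCapacity_eq_one_of_compl {A : Set Ω} (hA : MeasurableSet A)
    (h0 : S.capacity Aᶜ = 0) : S.lowerCapacity ⟨A, hA⟩ = 1 := by
  have hi := S.indicator_mem hA
  have e : S.lowerCapacity ⟨A, hA⟩ =
      -S.expect (fun ω => -A.indicator (fun _ => (1 : ℝ)) ω) := by
    rw [expect_eq (neg_mem hi)]
    rfl
  rw [e]
  have h1 := expect_add_const (S.indicator_mem hA.compl) (-1)
  have h2 : (fun ω => -A.indicator (fun _ => (1 : ℝ)) ω) =
      fun ω => Aᶜ.indicator (fun _ => (1 : ℝ)) ω + -1 := by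
    funext ω
    by_cases h : ω ∈ A <;> simp [h]
  rw [h2, h1]
  change -(S.capacity Aᶜ + -1) = 1
  rw [h0]
  norm_num

/-! ### Moment bounds and weak laws -/

theorem expect_sq_sub_const_le {C M c : ℝ} {X : S.H} (g : SimpleFunc ℝ ℝ)
    (hsq : (fun ω => (X : Ω → ℝ) ω ^ 2) ∈ S.H)
    (hle : S.expect (fun ω => (X : Ω → ℝ) ω ^ 2) ≤ C)
    (hg : ∀ y, |g y| ≤ |y| + 1) (hc : |c| ≤ M) :
    S.expect (fun ω => (g.map fun y => y - c) ((X : Ω → ℝ) ω) ^ 2) ≤ 4 * C + 4 + 2 * M ^ 2 := by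
  have hm := simpleFunc_comp_mem (S := S) ((g.map fun y => y - c).map fun y => y ^ 2)
    (measurable_coe X)
  refine (expect_mono hm (add_mem (mul_mem 4 hsq) (S.const_mem (4 + 2 * M ^ 2)))
    fun ω => ?_).trans ?_
  · simp only [SimpleFunc.map_apply]
    set y := (X : Ω → ℝ) ω
    have h1 : (g y) ^ 2 ≤ (|y| + 1) ^ 2 := sq_le_sq.mpr (by
      rw [abs_of_nonneg (by positivity : 0 ≤ |y| + 1)]
      exact hg y)
    have h2 : c ^ 2 ≤ M ^ 2 := sq_le_sq.mpr (hc.trans (le_abs_self M))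
    nlinarith [sq_nonneg (g y + c), sq_nonneg (|y| - 1), sq_abs y]
  · rw [expect_add_const (mul_mem 4 hsq), expect_mul hsq (by norm_num)]
    linarith

theorem expect_abs_le {C : ℝ} {X : S.H} (hsq : (fun ω => (X : Ω → ℝ) ω ^ 2) ∈ S.H)
    (hle : S.expect (fun ω => (X : Ω → ℝ) ω ^ 2) ≤ C) :
    S.expect (fun ω => |(X : Ω → ℝ) ω|) ≤ C + 1 := by
  refine (expect_mono (S.abs_mem X.2) (add_mem hsq (S.const_mem 1)) fun ω => ?_).trans ?_
  · nlinarith [sq_nonneg (|(X : Ω → ℝ) ω| - 1), sq_abs ((X : Ω → ℝ) ω),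
      abs_nonneg ((X : Ω → ℝ) ω)]
  · rw [expect_add_const hsq]
    linarith

theorem expect_le_and_neg_le {C : ℝ} {X : S.H} (hsq : (fun ω => (X : Ω → ℝ) ω ^ 2) ∈ S.H)
    (hle : S.expect (fun ω => (X : Ω → ℝ) ω ^ 2) ≤ C) :
    S.expect (X : Ω → ℝ) ≤ C + 1 ∧ -(C + 1) ≤ -S.expect (fun ω => -(X : Ω → ℝ) ω) := by
  have h := expect_abs_le hsq hle
  have h1 := expect_mono X.2 (S.abs_mem X.2) fun ω => le_abs_self _
  have h2 := expect_mono (neg_mem X.2) (S.abs_mem X.2) fun ω => neg_le_abs _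
  constructor <;> linarith

theorem measurable_sum_sub (X : ℕ → S.H) (m : ℕ → ℝ) (s : Finset ℕ) :
    Measurable fun ω => ∑ i ∈ s, ((X i : Ω → ℝ) ω - m i) :=
  Finset.measurable_fun_sum _ fun i _ => (measurable_coe (X i)).sub_const _

/-- One-sided weak law of large numbers. -/
theorem capacity_le_sum_sub_le {X : ℕ → S.H}
    (hindep : ∀ n : ℕ, S.IsIndependentOf (X (n + 1)) (fun j : Fin (n + 1) => X j))
    {C : ℝ} (hC : 0 < C) (hsq : ∀ i, (fun ω => (X i : Ω → ℝ) ω ^ 2) ∈ S.H)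
    (hle : ∀ i, S.expect (fun ω => (X i : Ω → ℝ) ω ^ 2) ≤ C)
    {N : ℕ} (hN : 0 < N) {ε : ℝ} (hε : 0 < ε) :
    S.capacity {ω | ε * N ≤ ∑ i ∈ Finset.range N, ((X i : Ω → ℝ) ω - S.expect (X i : Ω → ℝ))} ≤
      16 * (4 * C + 4 + 2 * (C + 2) ^ 2) / ε ^ 2 / N := by
  set D := 4 * C + 4 + 2 * (C + 2) ^ 2 with hD
  have hN' : (0 : ℝ) < N := Nat.cast_pos.mpr hN
  -- The slack `η` pays for replacing `X i` by simple functions. Of the bounds on `δ`, `1` keeps the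
  -- centring within `C + 2`, `ε / 4` keeps `N * δ ≤ r`, and `η * ε / 4` makes the Markov term at
  -- most `η`.
  refine le_of_forall_pos_le_add fun η hη => ?_
  obtain ⟨δ, hδ, hδ1, hδε, hδη⟩ : ∃ δ : ℝ, 0 < δ ∧ δ ≤ 1 ∧ δ ≤ ε / 4 ∧ δ ≤ η * ε / 4 :=
    ⟨min 1 (min (ε / 4) (η * ε / 4)), by positivity, min_le_left _ _,
      (min_le_right _ _).trans (min_le_left _ _), (min_le_right _ _).trans (min_le_right _ _)⟩
  choose g hg1 hg2 using fun i => exists_simpleFunc_expect_abs_sub_le hC hδ (hsq i) (hle i)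
  set m : ℕ → ℝ := fun i => S.expect (X i : Ω → ℝ) with hm
  have hgm : ∀ i, (fun ω => g i ((X i : Ω → ℝ) ω)) ∈ S.H := fun i =>
    simpleFunc_comp_mem _ (measurable_coe _)
  -- The extra `δ` compensates for the approximation error in the mean, so that the upper mean is at
  -- most zero.
  let h : ℕ → SimpleFunc ℝ ℝ := fun i => (g i).map fun y => y - (m i + δ)
  have hh : ∀ i y, h i y = g i y - (m i + δ) := fun i y => rfl
  have hmean : ∀ i, S.expect (fun ω => h i ((X i : Ω → ℝ) ω)) ≤ 0 := by
    intro i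
    have h1 := expect_add_const (hgm i) (-(m i + δ))
    have h2 := expect_le_add_abs_sub (hgm i) (X i).2
    simp only [abs_sub_comm (g i _)] at h2
    simp only [hh, sub_eq_add_neg _ (m i + δ)]
    rw [h1]
    have := hg2 i
    simp only [hm]
    linarith
  have hvar : ∀ i, S.expect (fun ω => h i ((X i : Ω → ℝ) ω) ^ 2) ≤ D := by
    intro i
    refine expect_sq_sub_const_le (g i) (hsq i) (hle i) (hg1 i) ?_
    have := expect_le_and_neg_le (hsq i) (hle i)
    have h3 := neg_expect_neg_le (X i).2
    rw [abs_le]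
    constructor <;> simp only [hm] <;> linarith
  have hU := expect_sq_posPart_sum_le hindep h hmean hvar N
  have hUm := sum_simpleFunc_comp_mem X h (fun a => max a 0 ^ 2) N
  have hdm : ∀ i, (fun ω => |(X i : Ω → ℝ) ω - g i ((X i : Ω → ℝ) ω)|) ∈ S.H := fun i =>
    S.abs_mem (sub_mem (X i).2 (hgm i))
  have hW := expect_sum_le (S := S) (Finset.range N) hdm
  have hW2 : ∑ i ∈ Finset.range N, S.expect (fun ω => |(X i : Ω → ℝ) ω - g i ((X i : Ω → ℝ) ω)|)
      ≤ N * δ := by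
    refine (Finset.sum_le_sum fun i _ => hg2 i).trans ?_
    simp
  have hWm := sum_mem (S := S) (s := Finset.range N) fun i _ => hdm i
  -- On the event, `W + U + N * δ ≥ 4 * r` with `N * δ ≤ r`, so `W ≥ r` or `U ≥ r`; one of the two
  -- Markov terms is then at least one.
  set r := ε * N / 4 with hr
  have hr0 : 0 < r := by positivity
  have hA : MeasurableSet {ω | ε * N ≤ ∑ i ∈ Finset.range N, ((X i : Ω → ℝ) ω - m i)} :=
    measurableSet_le measurable_const (measurable_sum_sub X m _)
  refine (capacity_le_expect hA (add_mem (mul_mem (r ^ 2)⁻¹ hUm) (mul_mem r⁻¹ hWm))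
    (fun ω => ?_) fun ω hω => ?_).trans ?_
  · have : 0 ≤ ∑ i ∈ Finset.range N, |(X i : Ω → ℝ) ω - g i ((X i : Ω → ℝ) ω)| :=
      Finset.sum_nonneg fun i _ => abs_nonneg _
    positivity
  · simp only [Set.mem_ofPred_eq] at hω
    have hs : ∑ i ∈ Finset.range N, ((X i : Ω → ℝ) ω - m i) ≤
        ∑ i ∈ Finset.range N, |(X i : Ω → ℝ) ω - g i ((X i : Ω → ℝ) ω)| +
          ∑ i ∈ Finset.range N, h i ((X i : Ω → ℝ) ω) + N * δ := by
      have : (N : ℝ) * δ = ∑ i ∈ Finset.range N, δ := by simp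
      rw [this, ← Finset.sum_add_distrib, ← Finset.sum_add_distrib]
      refine Finset.sum_le_sum fun i _ => ?_
      rw [hh]
      linarith [le_abs_self ((X i : Ω → ℝ) ω - g i ((X i : Ω → ℝ) ω))]
    set U := ∑ i ∈ Finset.range N, h i ((X i : Ω → ℝ) ω)
    have hW0 : 0 ≤ ∑ i ∈ Finset.range N, |(X i : Ω → ℝ) ω - g i ((X i : Ω → ℝ) ω)| :=
      Finset.sum_nonneg fun i _ => abs_nonneg _
    set W := ∑ i ∈ Finset.range N, |(X i : Ω → ℝ) ω - g i ((X i : Ω → ℝ) ω)|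
    have hNδ : N * δ ≤ r := by
      rw [hr]
      nlinarith
    rw [inv_mul_eq_div, inv_mul_eq_div]
    rcases le_total r W with hw | hw
    · have h1 : 1 ≤ W / r := (one_le_div hr0).mpr hw
      have : 0 ≤ max U 0 ^ 2 / r ^ 2 := by positivity
      linarith
    · have hu : r ≤ max U 0 := le_trans (by rw [hr] at *; linarith) (le_max_left _ _)
      have h1 : 1 ≤ max U 0 ^ 2 / r ^ 2 := by
        rw [one_le_div (by positivity)]
        exact pow_le_pow_left₀ hr0.le hu 2
      have : 0 ≤ W / r := by positivity
      linarith
  · refine (expect_add_le (mul_mem _ hUm) (mul_mem _ hWm)).trans ?_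
    rw [expect_mul hUm (by positivity), expect_mul hWm (by positivity)]
    have h1 : (r ^ 2)⁻¹ * S.expect (fun ω =>
        max (∑ i ∈ Finset.range N, h i ((X i : Ω → ℝ) ω)) 0 ^ 2) ≤ (r ^ 2)⁻¹ * (N * D) :=
      mul_le_mul_of_nonneg_left hU (by positivity)
    have h2 : r⁻¹ * S.expect (fun ω =>
        ∑ i ∈ Finset.range N, |(X i : Ω → ℝ) ω - g i ((X i : Ω → ℝ) ω)|) ≤
          r⁻¹ * (N * (η * ε / 4)) := by
      refine mul_le_mul_of_nonneg_left ((hW.trans hW2).trans ?_) (by positivity)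
      exact mul_le_mul_of_nonneg_left hδη hN'.le
    have e1 : (r ^ 2)⁻¹ * (N * D) = 16 * D / ε ^ 2 / N := by
      rw [hr]
      field_simp
      ring
    have e2 : r⁻¹ * (N * (η * ε / 4)) = η := by
      rw [hr]
      field_simp
    linarith

/-- The upper capacity charges every sequence of means between the lower and the upper ones. -/
theorem le_capacity_abs_sum_sub_lt {X : ℕ → S.H}
    (hindep : ∀ n : ℕ, S.IsIndependentOf (X (n + 1)) (fun j : Fin (n + 1) => X j))
    {C : ℝ} (hC : 0 < C) (hsq : ∀ i, (fun ω => (X i : Ω → ℝ) ω ^ 2) ∈ S.H)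
    (hle : ∀ i, S.expect (fun ω => (X i : Ω → ℝ) ω ^ 2) ≤ C)
    {β : ℕ → ℝ} (hβ1 : ∀ i, -S.expect (fun ω => -(X i : Ω → ℝ) ω) ≤ β i)
    (hβ2 : ∀ i, β i ≤ S.expect (X i : Ω → ℝ))
    {N : ℕ} (hN : 0 < N) {ε : ℝ} (hε : 0 < ε) :
    1 - 16 * (4 * C + 4 + 2 * (C + 2) ^ 2) / ε ^ 2 / N ≤
      S.capacity {ω | |∑ i ∈ Finset.range N, ((X i : Ω → ℝ) ω - β i)| < ε * N} := by
  set D := 4 * C + 4 + 2 * (C + 2) ^ 2 with hD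
  have hN' : (0 : ℝ) < N := Nat.cast_pos.mpr hN
  refine le_of_forall_pos_le_add fun η hη => ?_
  obtain ⟨δ, hδ, hδ1, hδε, hδη⟩ : ∃ δ : ℝ, 0 < δ ∧ δ ≤ 1 ∧ δ ≤ ε / 4 ∧ δ ≤ η * ε / 4 :=
    ⟨min 1 (min (ε / 4) (η * ε / 4)), by positivity, min_le_left _ _,
      (min_le_right _ _).trans (min_le_left _ _), (min_le_right _ _).trans (min_le_right _ _)⟩
  choose g hg1 hg2 using fun i => exists_simpleFunc_expect_abs_sub_le hC hδ (hsq i) (hle i)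
  have hgm : ∀ i, (fun ω => g i ((X i : Ω → ℝ) ω)) ∈ S.H := fun i =>
    simpleFunc_comp_mem _ (measurable_coe _)
  obtain ⟨ν, hν⟩ : ∃ ν : ℕ → ℝ, ∀ i, -S.expect (fun ω => -g i ((X i : Ω → ℝ) ω)) ≤ ν i ∧
      ν i ≤ S.expect (fun ω => g i ((X i : Ω → ℝ) ω)) ∧ |β i - ν i| ≤ δ := by
    -- Clamp `β i` to the interval between the lower and upper means of `g i (X i)`. Each endpoint
    -- is within `δ` of the corresponding mean of `X i`, so the clamp moves `β i` by at most `δ`.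
    refine ⟨fun i => max (-S.expect (fun ω => -g i ((X i : Ω → ℝ) ω)))
      (min (β i) (S.expect (fun ω => g i ((X i : Ω → ℝ) ω)))), fun i => ?_⟩
    have h1 := expect_le_add_abs_sub (X i).2 (hgm i)
    have h2 := expect_le_add_abs_sub (neg_mem (X i).2) (neg_mem (hgm i))
    simp only [neg_sub_neg, abs_sub_comm (g i _)] at h2
    have h3 := hg2 i
    have h4 := hβ1 i
    have h5 := hβ2 i
    refine ⟨le_max_left _ _, max_le (neg_expect_neg_le (hgm i)) (min_le_right _ _), ?_⟩
    rw [abs_le]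
    constructor
    · have : max (-S.expect (fun ω => -g i ((X i : Ω → ℝ) ω)))
          (min (β i) (S.expect (fun ω => g i ((X i : Ω → ℝ) ω)))) ≤ β i + δ :=
        max_le (by linarith) ((min_le_left _ _).trans (by linarith))
      linarith
    · have h6 : β i - δ ≤ min (β i) (S.expect (fun ω => g i ((X i : Ω → ℝ) ω))) :=
        le_min (by linarith) (by linarith)
      have h7 := h6.trans (le_max_right (-S.expect (fun ω => -g i ((X i : Ω → ℝ) ω))) _)
      linarith
  let h : ℕ → SimpleFunc ℝ ℝ := fun i => (g i).map fun y => y - ν i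
  have hh : ∀ i y, h i y = g i y - ν i := fun i y => rfl
  have hmean : ∀ i, 0 ≤ S.expect (fun ω => h i ((X i : Ω → ℝ) ω)) := by
    intro i
    simp only [hh, sub_eq_add_neg _ (ν i)]
    rw [expect_add_const (hgm i)]
    linarith [(hν i).2.1]
  have hmean' : ∀ i, 0 ≤ S.expect (fun ω => -h i ((X i : Ω → ℝ) ω)) := by
    intro i
    simp only [hh, neg_sub', sub_neg_eq_add]
    rw [expect_add_const (neg_mem (hgm i))]
    linarith [(hν i).1]
  have hvar : ∀ i, S.expect (fun ω => h i ((X i : Ω → ℝ) ω) ^ 2) ≤ D := by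
    intro i
    refine expect_sq_sub_const_le (g i) (hsq i) (hle i) (hg1 i) ?_
    have h1 := expect_le_and_neg_le (hsq i) (hle i)
    have h2 := abs_le.mp (hν i).2.2
    have h4 := hβ1 i
    have h5 := hβ2 i
    rw [abs_le]
    constructor <;> linarith
  have hU := le_expect_neg_sq_sum hindep h hmean hmean' hvar N
  have hUm := sum_simpleFunc_comp_mem X h (fun a => -a ^ 2) N
  have hdm : ∀ i, (fun ω => |(X i : Ω → ℝ) ω - g i ((X i : Ω → ℝ) ω)|) ∈ S.H := fun i =>
    S.abs_mem (sub_mem (X i).2 (hgm i))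
  have hW := expect_sum_le (S := S) (Finset.range N) hdm
  have hW2 : ∑ i ∈ Finset.range N, S.expect (fun ω => |(X i : Ω → ℝ) ω - g i ((X i : Ω → ℝ) ω)|)
      ≤ N * δ := by
    refine (Finset.sum_le_sum fun i _ => hg2 i).trans ?_
    simp
  have hWm := sum_mem (S := S) (s := Finset.range N) fun i _ => hdm i
  set r := ε * N / 4 with hr
  have hr0 : 0 < r := by positivity
  have hA : MeasurableSet {ω | |∑ i ∈ Finset.range N, ((X i : Ω → ℝ) ω - β i)| < ε * N} :=
    measurableSet_lt (measurable_sum_sub X β _).abs measurable_const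
  have hAm := S.indicator_mem hA
  -- Reverse Chebyshev: `1 - U² / r² ≤ I_A + W / r` pointwise, since `W < r` and `|U| < r` force the
  -- event.
  have hpt : S.expect (fun ω => (r ^ 2)⁻¹ * -(∑ i ∈ Finset.range N, h i ((X i : Ω → ℝ) ω)) ^ 2 + 1)
      ≤ S.expect (fun ω =>
        {ω | |∑ i ∈ Finset.range N, ((X i : Ω → ℝ) ω - β i)| < ε * N}.indicator
          (fun _ => (1 : ℝ)) ω +
        r⁻¹ * ∑ i ∈ Finset.range N, |(X i : Ω → ℝ) ω - g i ((X i : Ω → ℝ) ω)|) := by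
    refine expect_mono (add_mem (mul_mem _ hUm) (S.const_mem 1)) (add_mem hAm (mul_mem _ hWm))
      fun ω => ?_
    have hs : |∑ i ∈ Finset.range N, ((X i : Ω → ℝ) ω - β i)| ≤
        ∑ i ∈ Finset.range N, |(X i : Ω → ℝ) ω - g i ((X i : Ω → ℝ) ω)| +
          |∑ i ∈ Finset.range N, h i ((X i : Ω → ℝ) ω)| + N * δ := by
      have e : ∑ i ∈ Finset.range N, ((X i : Ω → ℝ) ω - β i) =
          ∑ i ∈ Finset.range N, ((X i : Ω → ℝ) ω - g i ((X i : Ω → ℝ) ω)) +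
          ∑ i ∈ Finset.range N, h i ((X i : Ω → ℝ) ω) +
          ∑ i ∈ Finset.range N, (ν i - β i) := by
        rw [← Finset.sum_add_distrib, ← Finset.sum_add_distrib]
        refine Finset.sum_congr rfl fun i _ => ?_
        rw [hh]
        ring
      rw [e]
      refine (abs_add_three _ _ _).trans (add_le_add (add_le_add
        (Finset.abs_sum_le_sum_abs _ _) le_rfl) ((Finset.abs_sum_le_sum_abs _ _).trans ?_))
      refine (Finset.sum_le_sum fun i _ => (abs_sub_comm _ _).trans_le (hν i).2.2).trans ?_
      simp
    set U := ∑ i ∈ Finset.range N, h i ((X i : Ω → ℝ) ω)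
    have hW0 : 0 ≤ ∑ i ∈ Finset.range N, |(X i : Ω → ℝ) ω - g i ((X i : Ω → ℝ) ω)| :=
      Finset.sum_nonneg fun i _ => abs_nonneg _
    set W := ∑ i ∈ Finset.range N, |(X i : Ω → ℝ) ω - g i ((X i : Ω → ℝ) ω)|
    have hNδ : N * δ ≤ r := by
      rw [hr]
      nlinarith
    have hi : 0 ≤ {ω | |∑ i ∈ Finset.range N, ((X i : Ω → ℝ) ω - β i)| < ε * N}.indicator
        (fun _ => (1 : ℝ)) ω := Set.indicator_nonneg (fun _ _ => zero_le_one) _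
    rw [inv_mul_eq_div, inv_mul_eq_div, neg_div]
    have hW1 : 0 ≤ W / r := by positivity
    have hU1 : 0 ≤ U ^ 2 / r ^ 2 := by positivity
    rcases le_or_gt r W with hw | hw
    · have h1 : 1 ≤ W / r := (one_le_div hr0).mpr hw
      linarith
    · rcases le_or_gt r |U| with hu | hu
      · have h1 : 1 ≤ U ^ 2 / r ^ 2 := by
          rw [one_le_div (by positivity), ← sq_abs U]
          exact pow_le_pow_left₀ hr0.le hu 2
        linarith
      · have hmem : ω ∈ {ω | |∑ i ∈ Finset.range N, ((X i : Ω → ℝ) ω - β i)| < ε * N} := by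
          simp only [Set.mem_ofPred_eq]
          rw [hr] at *
          linarith
        rw [Set.indicator_of_mem hmem]
        linarith
  rw [expect_add_const (mul_mem _ hUm), expect_mul hUm (by positivity)] at hpt
  have hsum := hpt.trans (expect_add_le hAm (mul_mem _ hWm))
  rw [expect_mul hWm (by positivity)] at hsum
  have h1 : (r ^ 2)⁻¹ * -(N * D) ≤ (r ^ 2)⁻¹ * S.expect (fun ω =>
      -(∑ i ∈ Finset.range N, h i ((X i : Ω → ℝ) ω)) ^ 2) :=
    mul_le_mul_of_nonneg_left hU (by positivity)
  have h2 : r⁻¹ * S.expect (fun ω =>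
      ∑ i ∈ Finset.range N, |(X i : Ω → ℝ) ω - g i ((X i : Ω → ℝ) ω)|) ≤
        r⁻¹ * (N * (η * ε / 4)) := by
    refine mul_le_mul_of_nonneg_left ((hW.trans hW2).trans ?_) (by positivity)
    exact mul_le_mul_of_nonneg_left hδη hN'.le
  have e1 : (r ^ 2)⁻¹ * -(N * D) = -(16 * D / ε ^ 2 / N) := by
    rw [hr]
    field_simp
    ring
  have e2 : r⁻¹ * (N * (η * ε / 4)) = η := by
    rw [hr]
    field_simp
  unfold capacity
  linarith

/-- Cauchy–Schwarz and Markov, without independence. The quadratic dependence on the number of terms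
is affordable because this is applied only to gaps between consecutive squares. -/
theorem capacity_le_sum_abs_sub_le {X : ℕ → S.H} {C : ℝ} (hC : 0 < C)
    (hsq : ∀ i, (fun ω => (X i : Ω → ℝ) ω ^ 2) ∈ S.H)
    (hle : ∀ i, S.expect (fun ω => (X i : Ω → ℝ) ω ^ 2) ≤ C) {m : ℕ → ℝ}
    (hm : ∀ i, |m i| ≤ C + 1) (s : Finset ℕ) {r : ℝ} (hr : 0 < r) :
    S.capacity {ω | r ≤ ∑ i ∈ s, |(X i : Ω → ℝ) ω - m i|} ≤
      (s.card : ℝ) ^ 2 * (2 * C + 2 * (C + 1) ^ 2) / r ^ 2 := by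
  set D := 2 * C + 2 * (C + 1) ^ 2 with hD
  have hb : ∀ i, (fun ω => 2 * (X i : Ω → ℝ) ω ^ 2 + 2 * (C + 1) ^ 2) ∈ S.H := fun i =>
    add_mem (mul_mem 2 (hsq i)) (S.const_mem _)
  have hE : ∀ i, S.expect (fun ω => 2 * (X i : Ω → ℝ) ω ^ 2 + 2 * (C + 1) ^ 2) ≤ D := by
    intro i
    rw [expect_add_const (mul_mem 2 (hsq i)), expect_mul (hsq i) zero_le_two]
    linarith [hle i]
  have hsum := sum_mem (S := S) (s := s) fun i _ => hb i
  have hA : MeasurableSet {ω | r ≤ ∑ i ∈ s, |(X i : Ω → ℝ) ω - m i|} :=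
    measurableSet_le measurable_const
      (Finset.measurable_fun_sum _ fun i _ => ((measurable_coe (X i)).sub_const _).abs)
  refine (capacity_le_expect hA (mul_mem (s.card / r ^ 2) hsum) (fun ω => by positivity)
    fun ω hω => ?_).trans ?_
  · simp only [Set.mem_ofPred_eq] at hω
    have h1 : (∑ i ∈ s, |(X i : Ω → ℝ) ω - m i|) ^ 2 ≤
        s.card * ∑ i ∈ s, |(X i : Ω → ℝ) ω - m i| ^ 2 := sq_sum_le_card_mul_sum_sq
    have h2 : ∑ i ∈ s, |(X i : Ω → ℝ) ω - m i| ^ 2 ≤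
        ∑ i ∈ s, (2 * (X i : Ω → ℝ) ω ^ 2 + 2 * (C + 1) ^ 2) := by
      refine Finset.sum_le_sum fun i _ => ?_
      have h3 : m i ^ 2 ≤ (C + 1) ^ 2 := sq_le_sq.mpr ((hm i).trans (le_abs_self _))
      rw [sq_abs]
      nlinarith [sq_nonneg ((X i : Ω → ℝ) ω + m i)]
    have h4 : r ^ 2 ≤ s.card * ∑ i ∈ s, (2 * (X i : Ω → ℝ) ω ^ 2 + 2 * (C + 1) ^ 2) :=
      (pow_le_pow_left₀ hr.le hω 2).trans (h1.trans (mul_le_mul_of_nonneg_left h2 (by positivity)))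
    rw [div_mul_eq_mul_div, one_le_div (by positivity)]
    exact h4
  · rw [expect_mul hsum (by positivity)]
    have h1 : S.expect (fun ω => ∑ i ∈ s, (2 * (X i : Ω → ℝ) ω ^ 2 + 2 * (C + 1) ^ 2)) ≤
        s.card * D := by
      refine (expect_sum_le s hb).trans ((Finset.sum_le_sum fun i _ => hE i).trans ?_)
      simp
    refine (mul_le_mul_of_nonneg_left h1 (by positivity)).trans_eq ?_
    ring

/-! ### Strong law from above -/

theorem exists_null_forall_eventually_sum_sub_le_mul
    (hV : IsUpperContinuousCapacity S.upperCapacity) {X : ℕ → S.H}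
    (hindep : ∀ n : ℕ, S.IsIndependentOf (X (n + 1)) (fun j : Fin (n + 1) => X j))
    {C : ℝ} (hC : 0 < C) (hsq : ∀ i, (fun ω => (X i : Ω → ℝ) ω ^ 2) ∈ S.H)
    (hle : ∀ i, S.expect (fun ω => (X i : Ω → ℝ) ω ^ 2) ≤ C) {ε : ℝ} (hε : 0 < ε) :
    ∃ B : Set Ω, MeasurableSet B ∧ S.capacity B = 0 ∧ ∀ ω ∉ B, ∀ᶠ k : ℕ in atTop,
      ∑ i ∈ Finset.range k, ((X i : Ω → ℝ) ω - S.expect (X i : Ω → ℝ)) ≤ 2 * ε * k := by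
  set m : ℕ → ℝ := fun i => S.expect (X i : Ω → ℝ) with hm
  have hmb : ∀ i, |m i| ≤ C + 1 := fun i => by
    have h1 := expect_le_and_neg_le (hsq i) (hle i)
    have h2 := neg_expect_neg_le (X i).2
    rw [abs_le]
    exact ⟨h1.2.trans h2, h1.1⟩
  -- `P n` is a large deviation at time `(n + 1) ^ 2`, `Q n` a large absolute variation before the
  -- next square. The gap has at most `3 * (n + 1)` terms, so both capacities are `O(1 / (n + 1) ^
  -- 2)`, hence summable.
  let P : ℕ → Set Ω := fun n =>
    {ω | ε * ((n + 1) ^ 2 : ℕ) ≤ ∑ i ∈ Finset.range ((n + 1) ^ 2), ((X i : Ω → ℝ) ω - m i)}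
  let Q : ℕ → Set Ω := fun n => {ω | ε * ((n + 1) ^ 2 : ℕ) ≤
    ∑ i ∈ Finset.Ico ((n + 1) ^ 2) ((n + 2) ^ 2), |(X i : Ω → ℝ) ω - m i|}
  have hP : ∀ n, MeasurableSet (P n) := fun n =>
    measurableSet_le measurable_const (measurable_sum_sub X m _)
  have hQ : ∀ n, MeasurableSet (Q n) := fun n => measurableSet_le measurable_const
    (Finset.measurable_fun_sum _ fun i _ => ((measurable_coe (X i)).sub_const _).abs)
  set K := 16 * (4 * C + 4 + 2 * (C + 2) ^ 2) / ε ^ 2 +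
    9 * (2 * C + 2 * (C + 1) ^ 2) / ε ^ 2 with hK
  have hbound : ∀ n : ℕ, S.capacity (P n ∪ Q n) ≤ K * (1 / ((n + 1 : ℕ) : ℝ) ^ 2) := by
    intro n
    have h1 := capacity_le_sum_sub_le hindep hC hsq hle (N := (n + 1) ^ 2) (by positivity) hε
    have h2 := capacity_le_sum_abs_sub_le hC hsq hle hmb
      (Finset.Ico ((n + 1) ^ 2) ((n + 2) ^ 2)) (r := ε * ((n + 1) ^ 2 : ℕ)) (by positivity)
    have hcard : ((Finset.Ico ((n + 1) ^ 2) ((n + 2) ^ 2)).card : ℝ) ≤ 3 * ((n + 1 : ℕ) : ℝ) := by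
      have : (Finset.Ico ((n + 1) ^ 2) ((n + 2) ^ 2)).card ≤ 3 * (n + 1) := by
        rw [Nat.card_Ico, Nat.sub_le_iff_le_add]
        nlinarith
      exact_mod_cast this
    have h3 : ((Finset.Ico ((n + 1) ^ 2) ((n + 2) ^ 2)).card : ℝ) ^ 2 *
        (2 * C + 2 * (C + 1) ^ 2) / (ε * ((n + 1) ^ 2 : ℕ)) ^ 2 ≤
        9 * (2 * C + 2 * (C + 1) ^ 2) / ε ^ 2 * (1 / ((n + 1 : ℕ) : ℝ) ^ 2) := by
      have h4 : ((Finset.Ico ((n + 1) ^ 2) ((n + 2) ^ 2)).card : ℝ) ^ 2 ≤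
          (3 * ((n + 1 : ℕ) : ℝ)) ^ 2 := pow_le_pow_left₀ (by positivity) hcard 2
      have hn : (0 : ℝ) < ((n + 1 : ℕ) : ℝ) := by positivity
      calc _ ≤ (3 * ((n + 1 : ℕ) : ℝ)) ^ 2 * (2 * C + 2 * (C + 1) ^ 2) /
            (ε * ((n + 1) ^ 2 : ℕ)) ^ 2 := by gcongr
        _ = _ := by
          rw [Nat.cast_pow]
          field_simp
          norm_num
    refine (capacity_union_le (hP n) (hQ n)).trans ((add_le_add h1 (h2.trans h3)).trans_eq ?_)
    rw [hK, Nat.cast_pow]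
    ring
  have hsummable : Summable fun n : ℕ => K * (1 / ((n + 1 : ℕ) : ℝ) ^ 2) :=
    ((summable_nat_add_iff 1).mpr (Real.summable_one_div_nat_pow.mpr one_lt_two)).mul_left K
  have hPQ : ∀ n, MeasurableSet (P n ∪ Q n) := fun n => (hP n).union (hQ n)
  refine ⟨⋂ M, ⋃ n, (P (n + M) ∪ Q (n + M)), .iInter fun M => .iUnion fun n => hPQ _,
    capacity_frequently_eq_zero hV hPQ hsummable hbound, fun ω hω => ?_⟩
  simp only [Set.mem_iInter, Set.mem_iUnion, not_forall, not_exists] at hω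
  obtain ⟨M, hM⟩ := hω
  filter_upwards [eventually_ge_atTop ((M + 1) ^ 2)] with k hk
  -- `k` lies in the gap that starts at `(n + M + 1) ^ 2`, governed by the events of index `n + M`.
  obtain ⟨n, hn⟩ : ∃ n, Nat.sqrt k = n + 1 + M := by
    have : M + 1 ≤ Nat.sqrt k := Nat.le_sqrt'.mpr hk
    exact ⟨Nat.sqrt k - (M + 1), by omega⟩
  have hk1 : (n + M + 1) ^ 2 ≤ k := by
    have := Nat.sqrt_le' k
    rw [hn] at this
    exact le_trans (le_of_eq (by ring)) this
  have hk2 : k ≤ (n + M + 2) ^ 2 := by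
    have := Nat.lt_succ_sqrt' k
    rw [hn] at this
    exact this.le.trans (le_of_eq (by simp only [Nat.succ_eq_add_one]; ring))
  have hnot := hM n
  simp only [P, Q, Set.mem_union, Set.mem_ofPred_eq, not_or, not_le] at hnot
  rw [← Finset.sum_range_add_sum_Ico _ hk1]
  have h1 : ∑ i ∈ Finset.Ico ((n + M + 1) ^ 2) k, ((X i : Ω → ℝ) ω - m i) ≤
      ∑ i ∈ Finset.Ico ((n + M + 1) ^ 2) ((n + M + 2) ^ 2), |(X i : Ω → ℝ) ω - m i| :=
    (Finset.sum_le_sum fun i _ => le_abs_self _).trans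
      (Finset.sum_le_sum_of_subset_of_nonneg (Finset.Ico_subset_Ico_right hk2)
        fun i _ _ => abs_nonneg _)
  have h2 : ε * (((n + M + 1) ^ 2 : ℕ) : ℝ) ≤ ε * k :=
    mul_le_mul_of_nonneg_left (Nat.cast_le.mpr hk1) hε.le
  linarith [hnot.1, hnot.2]

/-- One-sided strong law of large numbers. -/
theorem exists_null_forall_eventually_sum_sub_le
    (hV : IsUpperContinuousCapacity S.upperCapacity) {X : ℕ → S.H}
    (hindep : ∀ n : ℕ, S.IsIndependentOf (X (n + 1)) (fun j : Fin (n + 1) => X j))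
    {C : ℝ} (hC : 0 < C) (hsq : ∀ i, (fun ω => (X i : Ω → ℝ) ω ^ 2) ∈ S.H)
    (hle : ∀ i, S.expect (fun ω => (X i : Ω → ℝ) ω ^ 2) ≤ C) :
    ∃ B : Set Ω, MeasurableSet B ∧ S.capacity B = 0 ∧ ∀ ω ∉ B, ∀ ε > 0, ∀ᶠ k : ℕ in atTop,
      ∑ i ∈ Finset.range k, ((X i : Ω → ℝ) ω - S.expect (X i : Ω → ℝ)) ≤ ε * k := by
  choose B hB hB0 hBω using fun j : ℕ => exists_null_forall_eventually_sum_sub_le_mul hV hindep hC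
    hsq hle (ε := 1 / ((j : ℝ) + 1)) (by positivity)
  refine ⟨⋃ j, B j, .iUnion hB, capacity_iUnion_eq_zero hV hB hB0, fun ω hω ε hε => ?_⟩
  obtain ⟨j, hj⟩ := exists_nat_one_div_lt (half_pos hε)
  have hj' : ω ∉ B j := fun h => hω (Set.mem_iUnion.mpr ⟨j, h⟩)
  filter_upwards [hBω j ω hj'] with k hk
  refine hk.trans (mul_le_mul_of_nonneg_right ?_ (Nat.cast_nonneg k))
  linarith

/-- Substitute `φ(-x, -y)` for the test function. This lets lower bounds follow from upper ones. -/
theorem IsIndependentOf.neg {n : ℕ} {Y : S.H} {X : Fin n → S.H} (h : S.IsIndependentOf Y X) :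
    S.IsIndependentOf (-Y) fun j => -X j := by
  intro φ hφ hXY hxY hX
  have hm : Measurable fun p : (Fin n → ℝ) × ℝ => φ (fun j => -p.1 j, -p.2) :=
    hφ.comp (by fun_prop)
  exact h (fun p => φ (fun j => -p.1 j, -p.2)) hm hXY (fun x => hxY fun j => -x j) hX

theorem tendsto_average_of_tendsto_average_abs_sub {u : ℕ → ℝ} {a : ℝ}
    (h : Tendsto (fun n : ℕ => (1 / (n : ℝ)) * ∑ i ∈ Finset.range n, |u i - a|) atTop (𝓝 0)) :
    Tendsto (fun n : ℕ => (∑ i ∈ Finset.range n, u i) / (n : ℝ)) atTop (𝓝 a) := by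
  rw [tendsto_iff_norm_sub_tendsto_zero]
  refine squeeze_zero' (.of_forall fun n => norm_nonneg _) ?_ h
  filter_upwards [eventually_gt_atTop 0] with n hn
  have hn' : (0 : ℝ) < n := Nat.cast_pos.mpr hn
  have e : (∑ i ∈ Finset.range n, u i) / (n : ℝ) - a =
      1 / (n : ℝ) * ∑ i ∈ Finset.range n, (u i - a) := by
    rw [Finset.sum_sub_distrib]
    simp
    field_simp
  rw [e, norm_mul, Real.norm_of_nonneg (by positivity)]
  exact mul_le_mul_of_nonneg_left (norm_sum_le _ _) (by positivity)

theorem measurable_sampleMean (X : ℕ → S.H) (n : ℕ) :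
    Measurable (sampleMean (fun i => (X i : Ω → ℝ)) n) :=
  (Finset.measurable_fun_sum _ fun i _ => measurable_coe (X i)).div_const _

theorem exists_null_forall_eventually_sampleMean_le
    (hV : IsUpperContinuousCapacity S.upperCapacity) {X : ℕ → S.H}
    (hindep : ∀ n : ℕ, S.IsIndependentOf (X (n + 1)) (fun j : Fin (n + 1) => X j))
    {C : ℝ} (hC : 0 < C) (hsq : ∀ i, (fun ω => (X i : Ω → ℝ) ω ^ 2) ∈ S.H)
    (hle : ∀ i, S.expect (fun ω => (X i : Ω → ℝ) ω ^ 2) ≤ C) {a : ℝ}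
    (ha : Tendsto (fun n : ℕ => (∑ i ∈ Finset.range n, S.expect (X i : Ω → ℝ)) / (n : ℝ))
      atTop (𝓝 a)) :
    ∃ B : Set Ω, MeasurableSet B ∧ S.capacity B = 0 ∧ ∀ ω ∉ B, ∀ z > a, ∀ᶠ k : ℕ in atTop,
      sampleMean (fun i => (X i : Ω → ℝ)) k ω ≤ z := by
  obtain ⟨B, hB, hB0, hBω⟩ := exists_null_forall_eventually_sum_sub_le hV hindep hC hsq hle
  refine ⟨B, hB, hB0, fun ω hω z hz => ?_⟩
  filter_upwards [hBω ω hω ((z - a) / 2) (by linarith), eventually_gt_atTop 0,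
    ha.eventually_lt_const (show a < (z + a) / 2 by linarith)] with k h1 h2 h3
  have hk : (0 : ℝ) < k := Nat.cast_pos.mpr h2
  rw [Finset.sum_sub_distrib] at h1
  rw [div_lt_iff₀ hk] at h3
  rw [sampleMean, div_le_iff₀ hk]
  linarith

/-! ### Recurrence of the sample means near an admissible value -/

theorem exists_full_forall_frequently_abs_sampleMean_sub_lt
    (hV : IsUpperContinuousCapacity S.upperCapacity) {X : ℕ → S.H}
    (hindep : ∀ n : ℕ, S.IsIndependentOf (X (n + 1)) (fun j : Fin (n + 1) => X j))
    {C : ℝ} (hC : 0 < C) (hsq : ∀ i, (fun ω => (X i : Ω → ℝ) ω ^ 2) ∈ S.H)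
    (hle : ∀ i, S.expect (fun ω => (X i : Ω → ℝ) ω ^ 2) ≤ C)
    {β : ℕ → ℝ} (hβ1 : ∀ i, -S.expect (fun ω => -(X i : Ω → ℝ) ω) ≤ β i)
    (hβ2 : ∀ i, β i ≤ S.expect (X i : Ω → ℝ)) {b : ℝ}
    (hb : Tendsto (fun n : ℕ => (∑ i ∈ Finset.range n, β i) / (n : ℝ)) atTop (𝓝 b)) :
    ∃ I : Set Ω, MeasurableSet I ∧ S.capacity I = 1 ∧ ∀ ω ∈ I, ∀ ε > 0, ∃ᶠ k : ℕ in atTop,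
      |sampleMean (fun i => (X i : Ω → ℝ)) k ω - b| < ε := by
  let A : ℝ → ℕ → Set Ω := fun ε k => {ω | |sampleMean (fun i => (X i : Ω → ℝ)) k ω - b| < ε}
  have hA : ∀ ε k, MeasurableSet (A ε k) := fun ε k =>
    measurableSet_lt ((measurable_sampleMean X k).sub_const b).abs measurable_const
  -- The starting time and the tolerance share the index `m`, so a single decreasing sequence
  -- encodes "arbitrarily late and arbitrarily close".
  let B : ℕ → Set Ω := fun m => ⋃ k ≥ m, A (1 / ((m : ℝ) + 1)) k
  have hB : ∀ m, MeasurableSet (B m) := fun m => .iUnion fun k => .iUnion fun _ => hA _ _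
  have hB1 : ∀ m, 1 ≤ S.capacity (B m) := by
    intro m
    set ε := 1 / ((m : ℝ) + 1)
    have hε : 0 < ε := by positivity
    have hlim : Tendsto (fun N : ℕ => 1 - 16 * (4 * C + 4 + 2 * (C + 2) ^ 2) / (ε / 2) ^ 2 / N)
        atTop (𝓝 (1 - 0)) := tendsto_const_nhds.sub (tendsto_const_div_atTop_nhds_zero_nat _)
    rw [sub_zero] at hlim
    refine le_of_tendsto hlim ?_
    filter_upwards [eventually_ge_atTop m, eventually_gt_atTop 0,
      (tendsto_iff_norm_sub_tendsto_zero.mp hb).eventually_lt_const (half_pos hε)] with N h1 h2 h3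
    refine (le_capacity_abs_sum_sub_lt hindep hC hsq hle hβ1 hβ2 h2 (half_pos hε)).trans ?_
    refine capacity_mono (measurableSet_lt (measurable_sum_sub X β _).abs measurable_const) (hB m)
      fun ω hω => Set.mem_biUnion (Set.mem_Ici.mpr h1) ?_
    simp only [Set.mem_ofPred_eq] at hω
    have hN : (0 : ℝ) < N := Nat.cast_pos.mpr h2
    have e : sampleMean (fun i => (X i : Ω → ℝ)) N ω - b =
        (∑ i ∈ Finset.range N, ((X i : Ω → ℝ) ω - β i)) / N +
          ((∑ i ∈ Finset.range N, β i) / N - b) := by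
      rw [sampleMean, Finset.sum_sub_distrib]
      ring
    simp only [A, Set.mem_ofPred_eq]
    rw [e]
    refine (abs_add_le _ _).trans_lt ?_
    rw [Real.norm_eq_abs] at h3
    have h4 : |(∑ i ∈ Finset.range N, ((X i : Ω → ℝ) ω - β i)) / N| < ε / 2 := by
      rwa [abs_div, abs_of_pos hN, div_lt_iff₀ hN]
    linarith
  have hanti : Antitone B := by
    intro m n hmn ω hω
    simp only [B, A, Set.mem_iUnion, Set.mem_ofPred_eq] at hω ⊢
    obtain ⟨k, hk, h⟩ := hω
    exact ⟨k, hmn.trans hk, h.trans_le (Nat.one_div_le_one_div hmn)⟩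
  refine ⟨⋂ m, B m, .iInter hB, le_antisymm ?_
    (ge_of_tendsto' (tendsto_capacity_of_antitone hV hB hanti) hB1), fun ω hω ε hε => ?_⟩
  · rw [capacity_eq (.iInter hB)]
    exact (hV.mem_Icc _).2
  · rw [frequently_atTop]
    intro N
    obtain ⟨j, hj⟩ := exists_nat_one_div_lt hε
    have := Set.mem_iInter.mp hω (max N j)
    simp only [B, A, Set.mem_iUnion, Set.mem_ofPred_eq] at this
    obtain ⟨k, hk, h⟩ := this
    exact ⟨k, (le_max_left N j).trans hk,
      (h.trans_le (Nat.one_div_le_one_div (le_max_right N j))).trans hj⟩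

theorem capacity_eq_one_of_subset_union (hV : IsUpperContinuousCapacity S.upperCapacity)
    {A B I : Set Ω} (hA : MeasurableSet A) (hB : MeasurableSet B) (hI : MeasurableSet I)
    (hB0 : S.capacity B = 0) (hI1 : S.capacity I = 1) (hsub : I ⊆ A ∪ B) :
    S.upperCapacity ⟨A, hA⟩ = 1 := by
  refine le_antisymm (hV.mem_Icc _).2 ?_
  rw [← capacity_eq hA]
  have h1 := capacity_mono (S := S) hI (hA.union hB) hsub
  have h2 := capacity_union_le (S := S) hA hB
  linarith

end SublinearExpectationSpace

/-! ### Limits in the extended reals, tested against real bounds -/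

theorem EReal.limsup_coe_le_of_forall_eventually_le {u : ℕ → ℝ} {a : ℝ}
    (h : ∀ z > a, ∀ᶠ n in atTop, u n ≤ z) : limsup (fun n => (u n : EReal)) atTop ≤ a := by
  rw [← EReal.le_of_forall_lt_iff_le]
  intro z hz
  refine limsup_le_of_le (by isBoundedDefault) ?_
  filter_upwards [h z (EReal.coe_lt_coe_iff.mp hz)] with n hn
  exact EReal.coe_le_coe_iff.mpr hn

theorem EReal.le_liminf_coe_of_forall_eventually_le {u : ℕ → ℝ} {a : ℝ}
    (h : ∀ z < a, ∀ᶠ n in atTop, z ≤ u n) : (a : EReal) ≤ liminf (fun n => (u n : EReal)) atTop := by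
  rw [← EReal.ge_of_forall_gt_iff_ge]
  intro z hz
  refine le_liminf_of_le (by isBoundedDefault) ?_
  filter_upwards [h z (EReal.coe_lt_coe_iff.mp hz)] with n hn
  exact EReal.coe_le_coe_iff.mpr hn

theorem EReal.liminf_coe_le_of_forall_frequently_le {u : ℕ → ℝ} {a : ℝ}
    (h : ∀ z > a, ∃ᶠ n in atTop, u n ≤ z) : liminf (fun n => (u n : EReal)) atTop ≤ a := by
  rw [← EReal.le_of_forall_lt_iff_le]
  intro z hz
  refine liminf_le_of_frequently_le ?_ (by isBoundedDefault)
  exact (h z (EReal.coe_lt_coe_iff.mp hz)).mono fun n hn => EReal.coe_le_coe_iff.mpr hn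

theorem EReal.le_limsup_coe_of_forall_frequently_le {u : ℕ → ℝ} {a : ℝ}
    (h : ∀ z < a, ∃ᶠ n in atTop, z ≤ u n) : (a : EReal) ≤ limsup (fun n => (u n : EReal)) atTop := by
  rw [← EReal.ge_of_forall_gt_iff_ge]
  intro z hz
  refine le_limsup_of_frequently_le ?_ (by isBoundedDefault)
  exact (h z (EReal.coe_lt_coe_iff.mp hz)).mono fun n hn => EReal.coe_le_coe_iff.mpr hn

/-! ### The strong law -/

open SublinearExpectationSpace

/-- The term `X i` stands for the random variable number `i + 1` of the sequence. Upper and lower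
limits are taken in the extended reals. -/
theorem theorem3p2 {Ω : Type*} [MeasurableSpace Ω] (S : SublinearExpectationSpace Ω)
    (hV : IsUpperContinuousCapacity S.upperCapacity)
    (X : ℕ → S.H)
    (hindep : ∀ n : ℕ, S.IsIndependentOf (X (n + 1)) (fun j : Fin (n + 1) => X j))
    (muLo muHi : ℕ → ℝ)
    (hmuHi : ∀ i, S.E (X i) = muHi i) (hmuLo : ∀ i, S.conj (X i) = muLo i)
    (mLo mHi : ℝ)
    (hlo : Tendsto (fun n : ℕ => (1 / (n : ℝ)) * ∑ i ∈ Finset.range n, |muLo i - mLo|)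
      atTop (𝓝 0))
    (hhi : Tendsto (fun n : ℕ => (1 / (n : ℝ)) * ∑ i ∈ Finset.range n, |muHi i - mHi|)
      atTop (𝓝 0))
    (hsq : ∀ i, (fun ω => |(X i : Ω → ℝ) ω| ^ 2) ∈ S.H)
    (hbdd : BddAbove (Set.range fun i => S.E ⟨_, hsq i⟩)) :
    (∃ hA : MeasurableSet {ω : Ω |
        (mLo : EReal) ≤ liminf (fun n => (sampleMean (fun i => (X i : Ω → ℝ)) n ω : EReal)) atTop ∧
        liminf (fun n => (sampleMean (fun i => (X i : Ω → ℝ)) n ω : EReal)) atTop ≤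
          limsup (fun n => (sampleMean (fun i => (X i : Ω → ℝ)) n ω : EReal)) atTop ∧
        limsup (fun n => (sampleMean (fun i => (X i : Ω → ℝ)) n ω : EReal)) atTop ≤ (mHi : EReal)},
      S.lowerCapacity ⟨_, hA⟩ = 1) ∧
    (∀ b ∈ Set.Icc mLo mHi,
      ∃ hA : MeasurableSet {ω : Ω |
          liminf (fun n => ((|sampleMean (fun i => (X i : Ω → ℝ)) n ω - b| : ℝ) : EReal))
            atTop = 0},
        S.upperCapacity ⟨_, hA⟩ = 1) ∧
    (∃ hA : MeasurableSet {ω : Ω |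
        limsup (fun n => (sampleMean (fun i => (X i : Ω → ℝ)) n ω : EReal)) atTop = (mHi : EReal)},
      S.upperCapacity ⟨_, hA⟩ = 1) ∧
    (∃ hA : MeasurableSet {ω : Ω |
        liminf (fun n => (sampleMean (fun i => (X i : Ω → ℝ)) n ω : EReal)) atTop = (mLo : EReal)},
      S.upperCapacity ⟨_, hA⟩ = 1) := by
  set M := fun n => sampleMean (fun i => (X i : Ω → ℝ)) n with hM
  have hMm : ∀ n, Measurable fun ω => ((M n ω : ℝ) : EReal) := fun n =>
    (measurable_sampleMean X n).coe_real_ereal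
  have hsup : Measurable fun ω => limsup (fun n => ((M n ω : ℝ) : EReal)) atTop :=
    Measurable.limsup hMm
  have hinf : Measurable fun ω => liminf (fun n => ((M n ω : ℝ) : EReal)) atTop :=
    Measurable.liminf hMm
  obtain ⟨C₀, hC₀⟩ := hbdd
  obtain ⟨C, hC, hCC⟩ : ∃ C : ℝ, 0 < C ∧ C₀ ≤ C :=
    ⟨max C₀ 1, lt_max_of_lt_right one_pos, le_max_left _ _⟩
  have hsq' : ∀ i, (fun ω => (X i : Ω → ℝ) ω ^ 2) ∈ S.H := fun i => by
    simpa only [sq_abs] using hsq i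
  have hle : ∀ i, S.expect (fun ω => (X i : Ω → ℝ) ω ^ 2) ≤ C := fun i => by
    have h1 := (hC₀ ⟨i, rfl⟩).trans hCC
    simp only [← expect_eq, sq_abs] at h1
    exact h1
  have hEhi : ∀ i, S.expect (X i : Ω → ℝ) = muHi i := fun i => (expect_coe (X i)).trans (hmuHi i)
  have hElo : ∀ i, S.expect (fun ω => -(X i : Ω → ℝ) ω) = -muLo i := fun i => by
    rw [← hmuLo i, conj, neg_neg]
    exact expect_coe (-X i)
  have hhi' := tendsto_average_of_tendsto_average_abs_sub hhi
  have hlo' := tendsto_average_of_tendsto_average_abs_sub hlo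
  have hlohi : ∀ i, muLo i ≤ muHi i := fun i => by
    have := neg_expect_neg_le (X i).2
    rwa [hElo, hEhi, neg_neg] at this
  have hm : mLo ≤ mHi := le_of_tendsto_of_tendsto' hlo' hhi' fun n =>
    div_le_div_of_nonneg_right (Finset.sum_le_sum fun i _ => hlohi i) n.cast_nonneg
  obtain ⟨B₁, hB₁, hB₁0, hB₁ω⟩ := exists_null_forall_eventually_sampleMean_le hV hindep hC hsq' hle
    (a := mHi) (by simpa only [hEhi] using hhi')
  obtain ⟨B₂, hB₂, hB₂0, hB₂ω⟩ := exists_null_forall_eventually_sampleMean_le hV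
    (X := fun i => -X i) (fun n => (hindep n).neg) hC
    (fun i => by simpa using hsq' i) (fun i => by simpa using hle i)
    (a := -mLo) (by
      have e : ∀ i, S.expect ((-X i : S.H) : Ω → ℝ) = -muLo i := hElo
      simp only [e, Finset.sum_neg_distrib, neg_div]
      exact hlo'.neg)
  have hup : ∀ ω ∉ B₁, limsup (fun n => ((M n ω : ℝ) : EReal)) atTop ≤ mHi := fun ω hω =>
    EReal.limsup_coe_le_of_forall_eventually_le (hB₁ω ω hω)
  have hdown : ∀ ω ∉ B₂, mLo ≤ liminf (fun n => ((M n ω : ℝ) : EReal)) atTop := fun ω hω =>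
    EReal.le_liminf_coe_of_forall_eventually_le fun z hz => by
      filter_upwards [hB₂ω ω hω (-z) (neg_lt_neg hz)] with k hk
      have e : sampleMean (fun i => ((-X i : S.H) : Ω → ℝ)) k ω = -M k ω := by
        simp [hM, sampleMean, neg_div]
      rw [e] at hk
      linarith
  have hfreq : ∀ b ∈ Set.Icc mLo mHi, ∃ I : Set Ω, MeasurableSet I ∧ S.capacity I = 1 ∧
      ∀ ω ∈ I, ∀ ε > 0, ∃ᶠ k : ℕ in atTop, |M k ω - b| < ε := by
    intro b hb
    -- Writing `b = p * mLo + q * mHi` as a convex combination, the same weights applied to `muLo i`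
    -- and `muHi i` give admissible centrings whose averages tend to `b`.
    rw [← segment_eq_Icc hm] at hb
    obtain ⟨p, q, hp, hq, hpq, rfl⟩ := hb
    refine exists_full_forall_frequently_abs_sampleMean_sub_lt hV hindep hC hsq' hle
      (β := fun i => p * muLo i + q * muHi i) (fun i => ?_) (fun i => ?_) ?_
    · rw [hElo, neg_neg]
      have := mul_le_mul_of_nonneg_left (hlohi i) hq
      calc muLo i = p * muLo i + q * muLo i := by rw [← add_mul, hpq, one_mul]
        _ ≤ _ := by linarith
    · rw [hEhi]
      have := mul_le_mul_of_nonneg_left (hlohi i) hp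
      calc _ ≤ p * muHi i + q * muHi i := by linarith
        _ = muHi i := by rw [← add_mul, hpq, one_mul]
    · refine ((hlo'.const_mul p).add (hhi'.const_mul q)).congr fun n => ?_
      rw [Finset.sum_add_distrib, ← Finset.mul_sum, ← Finset.mul_sum]
      ring
  refine ⟨?_, fun b hb => ?_, ?_, ?_⟩
  · have hA := (measurableSet_le (measurable_const (a := (mLo : EReal))) hinf).inter
      ((measurableSet_le hinf hsup).inter
        (measurableSet_le hsup (measurable_const (a := (mHi : EReal)))))
    refine ⟨hA, lowerCapacity_eq_one_of_compl hA (le_antisymm ?_ (capacity_nonneg hA.compl))⟩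
    refine (capacity_mono hA.compl (hB₁.union hB₂) fun ω hω => ?_).trans
      ((capacity_union_le hB₁ hB₂).trans (by rw [hB₁0, hB₂0, add_zero]))
    by_contra h
    rw [Set.mem_union, not_or] at h
    have hls : liminf (fun n => ((M n ω : ℝ) : EReal)) atTop ≤
        limsup (fun n => ((M n ω : ℝ) : EReal)) atTop := liminf_le_limsup
    exact hω ⟨hdown ω h.2, hls, hup ω h.1⟩
  · obtain ⟨I, hI, hI1, hIω⟩ := hfreq b hb
    refine ⟨measurableSet_eq_fun (Measurable.liminf fun n =>
      ((measurable_sampleMean X n).sub_const b).abs.coe_real_ereal) measurable_const,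
      -- No exceptional set is needed here: absolute values are nonnegative, so the lower bound on
      -- the liminf is automatic.
      capacity_eq_one_of_subset_union hV _ .empty hI capacity_empty hI1 fun ω hω => Or.inl ?_⟩
    refine le_antisymm ?_ ?_
    · exact EReal.liminf_coe_le_of_forall_frequently_le (a := 0) fun z hz =>
        (hIω ω hω z hz).mono fun k hk => hk.le
    · exact EReal.le_liminf_coe_of_forall_eventually_le (a := 0) fun z hz =>
        .of_forall fun k => hz.le.trans (abs_nonneg _)
  · obtain ⟨I, hI, hI1, hIω⟩ := hfreq mHi (Set.right_mem_Icc.mpr hm)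
    refine ⟨measurableSet_eq_fun hsup measurable_const,
      capacity_eq_one_of_subset_union hV _ hB₁ hI hB₁0 hI1 fun ω hω => ?_⟩
    by_cases h : ω ∈ B₁
    · exact Or.inr h
    · refine Or.inl (le_antisymm (hup ω h) (EReal.le_limsup_coe_of_forall_frequently_le
        fun z hz => (hIω ω hω (mHi - z) (sub_pos.mpr hz)).mono fun k hk => ?_))
      have := (abs_lt.mp hk).1
      simp only [hM] at this
      linarith
  · obtain ⟨I, hI, hI1, hIω⟩ := hfreq mLo (Set.left_mem_Icc.mpr hm)
    refine ⟨measurableSet_eq_fun hinf measurable_const,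
      capacity_eq_one_of_subset_union hV _ hB₂ hI hB₂0 hI1 fun ω hω => ?_⟩
    by_cases h : ω ∈ B₂
    · exact Or.inr h
    · refine Or.inl (le_antisymm (EReal.liminf_coe_le_of_forall_frequently_le
        fun z hz => (hIω ω hω (z - mLo) (sub_pos.mpr hz)).mono fun k hk => ?_) (hdown ω h))
      have := (abs_lt.mp hk).2
      simp only [hM] at this
      linarith
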